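/- **Setting.** Let $\mu$ be a singular cardinal with $\mathrm{cf}(\mu)=\kappa$ and let $\lambda=\mu^+$. For an ordinal $\delta$ and a property $P$, write $(\exists^*\alpha<\delta)P(\alpha)$ if $\{\alpha<\delta: P(\alpha)\}$ is unbounded below $\delta$, and $(\forall^*\alpha<\delta)P(\alpha)$ if $\{\alpha<\delta:P(\alpha)\text{ fails}\}$ is bounded below $\delta$. For a set $C$ of ordinals let $\mathrm{nacc}(C)=\{\alpha\in C:\sup(C\cap\alpha)<\alpha\}$ and $\mathrm{acc}(C)=C\setminus\mathrm{nacc}(C)$. *Good pair.* Let $S$ be a stationary subset of $\{\delta<\lambda:\mathrm{cf}(\delta)=\kappa\}$ and let $(\bar C,\bar I)$ be an $S$-good pair. That is, $\bar C=\langle C_\delta:\delta\in S\rangle$ with each $C_\delta$ closed and unbounded in $\delta$; $\sup\{|C_\delta|:\delta\in S\}<\mu$; $\bar I=\langle I_\delta:\delta\in S\rangle$, where $I_\delta$ is the ideal on $C_\delta$ generated by the sets $\{\gamma\in C_\delta:\gamma\in\mathrm{acc}(C_\delta)\text{ or }\mathrm{cf}(\gamma)<\alpha\text{ or }\gamma<\beta\}$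 for $\alpha<\mu$, $\beta<\delta$; and for every closed unbounded $E\subseteq\lambda$ the set $\{\delta\in S:E\cap C_\delta\notin I_\delta\}$ is stationary. The ideal $\mathrm{id}_p(\bar C,\bar I)$ consists of all $A\subseteq\lambda$ for which there is a closed unbounded $E\subseteq\lambda$ with $E\cap A\cap C_\delta\in I_\delta$ for all $\delta\in S\cap E$. *Walks.* Let $\bar e=\langle e_\alpha:\alpha<\lambda\rangle$ be a $C$-sequence (for limit $\alpha$, $e_\alpha$ is closed and unbounded in $\alpha$; for successor $\alpha$, $e_\alpha$ is a closed subset of $\alpha$ containing the predecessor of $\alpha$; $e_0=\emptyset$) that swallows $(\bar C,\bar I)$, with small members: $|e_\alpha|<\mu$ for all $\alpha<\lambda$, and $C_\delta\subseteq e_\alpha$ whenever $\delta\in e_\alpha\cap S$. For $\alpha<\beta<\lambda$ the minimal walk from $\beta$ to $\alpha$ is $\beta=\beta_0>\beta_1>\dots>\beta_{n+1}=\alpha$, where $\beta_{i+1}=\min(e_{\beta_i}\setminus\alpha)$. *Scale.* Let $(\vec\mu,\vec f)$ be a scale for $\mu$: $\vec\mu=\langle\mu_i:i<\kappa\rangle$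 is an increasing sequence of regular cardinals with supremum $\mu$ and $\kappa<\mu_0$, and $\vec f=\langle f_\alpha:\alpha<\lambda\rangle$ is a sequence of members of $\prod_{i<\kappa}\mu_i$ such that $f_\gamma<^*f_\delta$ for $\gamma<\delta<\lambda$, and every $f\in\prod_{i<\kappa}\mu_i$ satisfies $f<^*f_\alpha$ for some $\alpha<\lambda$; here $f<^*g$ means that $\{i<\kappa:g(i)\le f(i)\}$ is bounded in $\kappa$. For $\alpha,\beta<\lambda$ let $\Gamma(\alpha,\beta)=\sup\{i<\kappa:f_\beta(i)\le f_\alpha(i)\}$. For $\alpha<\beta<\lambda$ let $c(\alpha,\beta)=\beta_m$, where $\beta_0>\dots>\beta_{n+1}$ is the minimal walk from $\beta$ to $\alpha$ and $m\le n+1$ is least with $\Gamma(\alpha,\beta_m)\ne\Gamma(\alpha,\beta)$. **Theorem.** Suppose $\langle t_\alpha:\alpha<\lambda\rangle$ is a sequence of pairwise disjoint subsets of $\lambda$, each of cardinality less than $\kappa$. Then for $\mathrm{id}_p(\bar C,\bar I)$-almost all $\beta^*<\lambda$ (that is, for all $\beta^*<\lambda$ outside a set in $\mathrm{id}_p(\bar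 C,\bar I)$) the following holds: $$(\exists^*\beta<\lambda)(\forall^*i<\kappa)(\exists^*\alpha<\beta^*)(\forall\zeta\in t_\alpha)(\forall\xi\in t_\beta)\left[\zeta<\xi\ \wedge\ c(\zeta,\xi)=\beta^*\ \wedge\ \Gamma(\zeta,\xi)=i\right].$$ -/

import Mathlib

universe u

open Cardinal Ordinal Set

namespace SingWalk

/-- `C` is a closed unbounded subset of the ordinal `δ`. Cofinality in `Iio δ` means `∀ γ < δ, ∃ x ∈ C,
γ ≤ x`, so for a successor `δ` this says that `C` is a closed subset of `δ` which contains the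
predecessor of `δ`, and for `δ = 0` it says that `C` is empty. -/
def IsClubIn (δ : Ordinal.{u}) (C : Set Ordinal.{u}) : Prop :=
  C ⊆ Iio δ ∧ IsClub ((↑) ⁻¹' C : Set (Iio δ))

/-- `S` is a stationary subset of the ordinal `δ`. -/
def IsStationaryIn (δ : Ordinal.{u}) (S : Set Ordinal.{u}) : Prop :=
  S ⊆ Iio δ ∧ IsStationary ((↑) ⁻¹' S : Set (Iio δ))

/-- `(∃* α < δ) P α`: the set of `α < δ` satisfying `P` is unbounded below `δ`. -/
def UnboundedlyMany (δ : Ordinal.{u}) (P : Ordinal.{u} → Prop) : Prop :=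
  ∀ γ < δ, ∃ α, γ < α ∧ α < δ ∧ P α

/-- `(∀* α < δ) P α`: the set of `α < δ` failing `P` is bounded below `δ`. -/
def AlmostAll (δ : Ordinal.{u}) (P : Ordinal.{u} → Prop) : Prop :=
  ∃ γ < δ, ∀ α, γ < α → α < δ → P α

/-- `nacc(C)`, the set of non-accumulation points of `C`. -/
noncomputable def nacc (C : Set Ordinal.{u}) : Set Ordinal.{u} :=
  {α | α ∈ C ∧ sSup (C ∩ Iio α) < α}

/-- `acc(C)`, the set of accumulation points of `C`. -/
noncomputable def acc (C : Set Ordinal.{u}) : Set Ordinal.{u} := C \ nacc C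

/-- The ideal of sets generated by a family `G` of sets. -/
def generatedIdeal (G : Set (Set Ordinal.{u})) : Set (Set Ordinal.{u}) :=
  {A | ∃ F : Set (Set Ordinal.{u}), F.Finite ∧ F ⊆ G ∧ A ⊆ ⋃₀ F}

/-- The sets `{γ ∈ C : γ ∈ acc(C) or cf(γ) < α or γ < β}` for `α < μ` and `β < δ`. -/
def basicSmallSets (μ : Cardinal.{u}) (δ : Ordinal.{u}) (C : Set Ordinal.{u}) :
    Set (Set Ordinal.{u}) :=
  {B | ∃ α < μ, ∃ β < δ, B = {γ | γ ∈ C ∧ (γ ∈ acc C ∨ γ.cof < α ∨ γ < β)}}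

/-- The ideal `id_p(C̄, Ī)` on the ordinal `lam`, for sequences indexed by `S ⊆ lam`. -/
def idP (lam : Ordinal.{u}) (S : Set Ordinal.{u}) (C : Ordinal.{u} → Set Ordinal.{u})
    (I : Ordinal.{u} → Set (Set Ordinal.{u})) : Set (Set Ordinal.{u}) :=
  {A | A ⊆ Iio lam ∧ ∃ E, IsClubIn lam E ∧ ∀ δ ∈ S ∩ E, E ∩ A ∩ C δ ∈ I δ}

/-- `(C̄, Ī)` is an `S`-good pair for the stationary set `S ⊆ {δ < μ⁺ : cf(δ) = cf(μ)}`. -/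
structure IsGoodPair (μ : Cardinal.{u}) (S : Set Ordinal.{u}) (C : Ordinal.{u} → Set Ordinal.{u})
    (I : Ordinal.{u} → Set (Set Ordinal.{u})) : Prop where
  stationary : IsStationaryIn (Order.succ μ).ord S
  cof_eq : ∀ δ ∈ S, δ.cof = μ.ord.cof
  club : ∀ δ ∈ S, IsClubIn δ (C δ)
  /-- `sup {|C_δ| : δ ∈ S} < μ` -/
  card_bound : ∃ ν < μ, ∀ δ ∈ S, #(C δ) ≤ Cardinal.lift.{u + 1} ν
  ideal_eq : ∀ δ ∈ S, I δ = generatedIdeal (basicSmallSets μ δ (C δ))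
  guesses : ∀ E, IsClubIn (Order.succ μ).ord E →
    IsStationaryIn (Order.succ μ).ord {δ | δ ∈ S ∧ E ∩ C δ ∉ I δ}

/-- `ē = ⟨e_α : α < lam⟩` is a `C`-sequence on `lam`. -/
def IsCSequence (lam : Ordinal.{u}) (e : Ordinal.{u} → Set Ordinal.{u}) : Prop :=
  ∀ α < lam, IsClubIn α (e α)

/-- `ē` swallows the pair `(C̄, Ī)`, at the cardinal `μ`: every `e_α` with `α < μ⁺` has cardinality
less than `μ`, and `C_δ ⊆ e_α` whenever `δ ∈ e_α ∩ S`. -/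
def Swallows (μ : Cardinal.{u}) (e : Ordinal.{u} → Set Ordinal.{u}) (S : Set Ordinal.{u})
    (C : Ordinal.{u} → Set Ordinal.{u}) : Prop :=
  ∀ α < (Order.succ μ).ord, #(e α) < Cardinal.lift.{u + 1} μ ∧ ∀ δ ∈ e α ∩ S, C δ ⊆ e α

/-- `g <* h` for functions on the ordinal `k`: `{i < k : h i ≤ g i}` is bounded in `k`. -/
def EvLT (k : Ordinal.{u}) (g h : Ordinal.{u} → Ordinal.{u}) : Prop :=
  ∃ j < k, ∀ i < k, h i ≤ g i → i ≤ j

/-- `(⟨m_i : i < cf(μ)⟩, ⟨f_α : α < μ⁺⟩)` is a scale for `μ`. -/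
structure IsScale (μ : Cardinal.{u}) (m : Ordinal.{u} → Cardinal.{u})
    (f : Ordinal.{u} → Ordinal.{u} → Ordinal.{u}) : Prop where
  regular : ∀ i < μ.ord.cof.ord, (m i).IsRegular
  strictMonoOn : StrictMonoOn m (Iio μ.ord.cof.ord)
  isLUB : IsLUB (m '' Iio μ.ord.cof.ord) μ
  cof_lt : μ.ord.cof < m 0
  mem_prod : ∀ α < (Order.succ μ).ord, ∀ i < μ.ord.cof.ord, f α i < (m i).ord
  increasing : ∀ γ δ, γ < δ → δ < (Order.succ μ).ord → EvLT μ.ord.cof.ord (f γ) (f δ)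
  cofinal : ∀ g : Ordinal.{u} → Ordinal.{u}, (∀ i < μ.ord.cof.ord, g i < (m i).ord) →
    ∃ α < (Order.succ μ).ord, EvLT μ.ord.cof.ord g (f α)

/-- `Γ(α, β) = sup {i < k : f_β(i) ≤ f_α(i)}`, where `k = cf(μ)`. -/
noncomputable def Gam (k : Ordinal.{u}) (f : Ordinal.{u} → Ordinal.{u} → Ordinal.{u})
    (α β : Ordinal.{u}) : Ordinal.{u} :=
  sSup {i | i < k ∧ f β i ≤ f α i}

/-- The `i`-th point `β_i` of the minimal walk from `β` to `α` along `ē`: `β_0 = β` and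
`β_{i+1} = min (e_{β_i} \ α)`. It is meaningful up to the first `i` with `β_i = α`, where the walk
ends. -/
noncomputable def walk (e : Ordinal.{u} → Set Ordinal.{u}) (α β : Ordinal.{u}) : ℕ → Ordinal.{u}
  | 0 => β
  | i + 1 => sInf (e (walk e α β i) \ Iio α)

/-- `c(α, β)` for `α < β`: the point `β_m` of the minimal walk from `β` to `α`, where `m` is least
such that `Γ(α, β_m) ≠ Γ(α, β)`. The last point `α` of the walk has this property when `f` is a
scale, because `Γ(α, α) = k` while `Γ(α, β) < k`; so the least `m` never lies beyond the end of
the walk. -/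
noncomputable def col (k : Ordinal.{u}) (f : Ordinal.{u} → Ordinal.{u} → Ordinal.{u})
    (e : Ordinal.{u} → Set Ordinal.{u}) (α β : Ordinal.{u}) : Ordinal.{u} :=
  walk e α β (sInf {m : ℕ | Gam k f α (walk e α β m) ≠ Gam k f α β})

end SingWalk

namespace SingWalk

/-! Let `E` be the club of ordinals closed under the selections below, and suppose the bad points of
`E ∩ C δ` are `I δ`-positive for some `δ ∈ S ∩ E`. Take `β` beyond `δ` and beyond the failure bounds
of all those points. Each walk from `ξ ∈ t β` to `δ` reaches a ladder containing `δ`, hence `C δ`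
(`exists_common_walk`). Positivity gives a bad `b` of cofinality above `κ` and above the sizes of
these ladders, so the walk from `ξ` to any `ζ` just below `b` visits the same points `w > δ` and
then `b`. It remains to find `t α` just below `b` with `Γ(ζ, w) = i` for all these `w` and `Γ(ζ, b)
≠ i`. Choose `f ζ i` above every `f w i`, and `f ζ (i + 1) ≥ f b (i + 1)`
(`IsScale.exists_forall_mem_le`). Coordinates `j > i` are controlled by one `f ε`, with `ε < δ < w`,
dominating all candidates at once (`IsScale.exists_dominating`). Since `κ < cf b`, one threshold for
`i` serves unboundedly many `γ < b` (`exists_unboundedlyMany_le`). -/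

/-! ### Small families of ordinals and clubs of closure points. -/

theorem exists_lt_forall_lt_of_mk_lt_cof {ι : Type (u + 1)} {o : Ordinal.{u}}
    {F : ι → Ordinal.{u}} (hι : #ι < Cardinal.lift.{u + 1} o.cof) (hF : ∀ x, F x < o) :
    ∃ γ < o, ∀ x, F x < γ := by
  have h : ¬ IsCofinal (range fun x ↦ (⟨F x, hF x⟩ : Iio o)) := fun hc ↦ by
    have h1 := (Order.cof_le hc).trans mk_range_le
    rw [Ordinal.cof_Iio, ← Ordinal.lift_cof] at h1
    exact h1.not_gt hι
  obtain ⟨y, hy⟩ := not_isCofinal_iff.1 h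
  exact ⟨y, y.2, fun x ↦ hy _ (mem_range_self x)⟩

theorem exists_lt_forall_mem_lt {s : Set Ordinal.{u}} {o : Ordinal.{u}}
    {F : Ordinal.{u} → Ordinal.{u}} (hs : #s < Cardinal.lift.{u + 1} o.cof)
    (hF : ∀ x ∈ s, F x < o) : ∃ γ < o, ∀ x ∈ s, F x < γ := by
  obtain ⟨γ, hγ, h⟩ := exists_lt_forall_lt_of_mk_lt_cof (F := fun x : s ↦ F x) hs
    fun x ↦ hF x x.2
  exact ⟨γ, hγ, fun x hx ↦ h ⟨x, hx⟩⟩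

theorem mk_Iio_lt_lift {o : Ordinal.{u}} {c : Cardinal.{u}} (h : o < c.ord) :
    #(Iio o) < Cardinal.lift.{u + 1} c := by
  rw [Cardinal.mk_Iio_ordinal, Cardinal.lift_lt]
  exact lt_ord.1 h

/-- The ordinals below `(succ μ).ord` closed under a family of at most `μ` binary functions form
a club. -/
theorem isClubIn_closedUnder {μ : Cardinal.{u}} (hμ : ℵ₀ ≤ μ) {ι : Type (u + 1)}
    (hι : #ι ≤ Cardinal.lift.{u + 1} μ) (R : Ordinal.{u} → Ordinal.{u} → ι → Ordinal.{u})
    (hR : ∀ γ < (Order.succ μ).ord, ∀ b < (Order.succ μ).ord, ∀ x, R γ b x < (Order.succ μ).ord) :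
    IsClubIn (Order.succ μ).ord
      {ε | ε < (Order.succ μ).ord ∧ ∀ γ < ε, ∀ b < ε, ∀ x, R γ b x < ε} := by
  set lam := (Order.succ μ).ord with hlam
  have hreg : (Order.succ μ).IsRegular := isRegular_succ hμ
  have hcof : lam.cof = Order.succ μ := hreg.cof_ord
  have hlim : Order.IsSuccLimit lam := isSuccLimit_ord hreg.aleph0_le
  refine ⟨fun ε h ↦ h.1, ?_, ?_⟩
  · intro s hs _ _ a ha
    refine ⟨a.2, fun γ hγ b hb x ↦ ?_⟩
    have key : ∀ c : Ordinal.{u}, c < a → ∃ y ∈ s, c < y := fun c hc ↦ by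
      by_contra! hcon
      have : a ≤ ⟨c, hc.trans a.2⟩ := ha.2 fun y hy ↦ hcon y hy
      exact (Subtype.coe_le_coe.2 this).not_gt hc
    obtain ⟨y, hy, hmy⟩ := key (max γ b) (max_lt hγ hb)
    exact ((hs hy).2 γ ((le_max_left _ _).trans_lt hmy) b ((le_max_right _ _).trans_lt hmy) x
      ).trans_le (Subtype.coe_le_coe.2 (ha.1 hy))
  · have step : ∀ x < lam, ∃ y < lam, x < y ∧ ∀ γ ≤ x, ∀ b ≤ x, ∀ z, R γ b z < y := by
      intro x hx
      have hx1 : Order.succ x < lam := hlim.succ_lt hx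
      have hc : #(Iio (Order.succ x)) ≤ Cardinal.lift.{u + 1} μ := by
        rw [Cardinal.mk_Iio_ordinal, Cardinal.lift_le]
        exact Order.lt_succ_iff.1 (lt_ord.1 hx1)
      have hμ' : ℵ₀ ≤ Cardinal.lift.{u + 1} μ := by simpa using hμ
      have hcard : #(Iio (Order.succ x) × Iio (Order.succ x) × ι) <
          Cardinal.lift.{u + 1} lam.cof := by
        rw [hcof, Cardinal.lift_succ, Order.lt_succ_iff]
        simp only [mk_prod, Cardinal.lift_id]
        exact mul_le_of_le hμ' hc (mul_le_of_le hμ' hc hι)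
      obtain ⟨y, hy, hlt⟩ := exists_lt_forall_lt_of_mk_lt_cof hcard
        (F := fun p ↦ R p.1 p.2.1 p.2.2)
        fun p ↦ hR _ (lt_trans p.1.2 hx1) _ (lt_trans p.2.1.2 hx1) _
      refine ⟨max y (Order.succ x), max_lt hy hx1, ?_, fun γ hγ b hb z ↦ ?_⟩
      · exact (Order.lt_succ x).trans_le (le_max_right _ _)
      · exact (hlt (⟨γ, Order.lt_succ_iff.2 hγ⟩, ⟨b, Order.lt_succ_iff.2 hb⟩, z)).trans_le
          (le_max_left _ _)
    choose! Φ hΦ hlt hb using step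
    intro x
    let g : ℕ → Ordinal.{u} := fun n ↦ Φ^[n] x
    have hgs : ∀ n, g (n + 1) = Φ (g n) := fun n ↦ Function.iterate_succ_apply' Φ n x
    have hg : ∀ n, g n < lam := by
      intro n
      induction n with
      | zero => exact x.2
      | succ n ih => rw [hgs]; exact hΦ _ ih
    have hω : #(ULift.{u + 1} ℕ) < Cardinal.lift.{u + 1} lam.cof := by
      rw [hcof]
      simpa using hμ
    obtain ⟨B, hB, hgB⟩ := exists_lt_forall_lt_of_mk_lt_cof hω (F := fun n ↦ g n.down)
      fun n ↦ hg _
    have hbdd : BddAbove (range g) := ⟨B, by rintro _ ⟨n, rfl⟩; exact (hgB ⟨n⟩).le⟩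
    have hmono : StrictMono g := strictMono_nat_of_lt_succ fun n ↦ by
      rw [hgs]; exact hlt _ (hg n)
    have hsup : (⨆ n, g n) < lam := (ciSup_le fun n ↦ (hgB ⟨n⟩).le).trans_lt hB
    refine ⟨⟨⨆ n, g n, hsup⟩, ⟨hsup, fun γ hγ b hb' z ↦ ?_⟩, le_ciSup hbdd 0⟩
    obtain ⟨n, hn⟩ := exists_lt_of_lt_ciSup (max_lt hγ hb')
    refine (hb (g n) (hg n) γ ((le_max_left _ _).trans hn.le) b
      ((le_max_right _ _).trans hn.le) z).trans_le ?_
    rw [← hgs]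
    exact le_ciSup hbdd (n + 1)

/-! ### Minimal walks below a limit ordinal. -/

theorem walk_succ_eq (e : Ordinal.{u} → Set Ordinal.{u}) (α β : Ordinal.{u}) (l : ℕ) :
    walk e α β (l + 1) = walk e α (sInf (e β \ Iio α)) l := by
  induction l with
  | zero => rfl
  | succ l ih => rw [walk, ih, walk]

/-- Otherwise `δ` would be a limit of points of `D`, and closedness would put it in `D`. -/
theorem exists_bound_of_notMem_club {β δ : Ordinal.{u}} {D : Set Ordinal.{u}} (hD : IsClubIn β D)
    (hδ : Order.IsSuccLimit δ) (hδβ : δ < β) (hn : δ ∉ D) :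
    ∃ γ < δ, ∀ y ∈ D, y < δ → y < γ := by
  by_contra! hcon
  apply hn
  have hmem : ∀ x < δ, ∃ y ∈ D, x ≤ y ∧ y < δ := fun x hx ↦ by
    obtain ⟨y, hy, h1, h2⟩ := hcon x hx
    exact ⟨y, hy, h2, h1⟩
  have := hD.2.isLUB_mem (t := {y : Iio β | (y : Ordinal) ∈ D ∧ (y : Ordinal) < δ})
    (x := ⟨δ, hδβ⟩) (fun y hy ↦ hy.1) ?_ ?_
  · exact this
  · obtain ⟨y, hy, -, h⟩ := hmem 0 hδ.bot_lt
    exact ⟨⟨y, h.trans hδβ⟩, hy, h⟩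
  · refine ⟨fun y hy ↦ hy.2.le, fun b hb ↦ ?_⟩
    by_contra! hlt
    have hlt' : (b : Ordinal) < δ := hlt
    obtain ⟨y, hy, h1, h2⟩ := hmem _ (hδ.succ_lt hlt')
    have : (⟨y, h2.trans hδβ⟩ : Iio β) ≤ b := hb ⟨hy, h2⟩
    exact (Order.succ_le_iff.1 h1).not_ge this

/-- The walks from `β` to the ordinals just below a limit `δ` begin as the walk from `β` to `δ`,
up to the point whose ladder contains `δ`. -/
theorem exists_walk_eq {e : Ordinal.{u} → Set Ordinal.{u}} {lam δ : Ordinal.{u}}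
    (he : IsCSequence lam e) (hδ : Order.IsSuccLimit δ) (β : Ordinal.{u}) (hδβ : δ < β)
    (hβ : β < lam) :
    ∃ n : ℕ, ∃ γ < δ, (∀ l ≤ n, δ < walk e δ β l ∧ walk e δ β l < lam) ∧
      δ ∈ e (walk e δ β n) ∧
      ∀ α, γ < α → α < δ → ∀ l ≤ n, walk e α β l = walk e δ β l := by
  induction β using WellFoundedLT.induction with
  | ind β ih =>
    by_cases hmem : δ ∈ e β
    · refine ⟨0, 0, hδ.bot_lt, ?_, hmem, ?_⟩
      · intro l hl
        obtain rfl := Nat.le_zero.1 hl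
        exact ⟨hδβ, hβ⟩
      · intro α _ _ l hl
        obtain rfl := Nat.le_zero.1 hl
        rfl
    · obtain ⟨γ₀, hγ₀, hbd⟩ := exists_bound_of_notMem_club (he β hβ) hδ hδβ hmem
      have hne : (e β \ Iio δ).Nonempty := by
        obtain ⟨y, hy, hle⟩ := (he β hβ).2.isCofinal ⟨δ, hδβ⟩
        exact ⟨y, hy, not_lt.2 hle⟩
      have hin := csInf_mem hne
      set β' := sInf (e β \ Iio δ) with hβ'
      have h1 : δ < β' := (not_lt.1 hin.2).lt_of_ne fun h ↦ hmem (h ▸ hin.1)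
      have h2 : β' < β := (he β hβ).1 hin.1
      obtain ⟨n, γ, hγ, hw, hδe, hα⟩ := ih β' h2 h1 (h2.trans hβ)
      -- The ladder has no points in `[γ₀, δ]`, so the next step is the same towards `α` as towards
      -- `δ`.
      have hset : ∀ α, γ₀ < α → α < δ → e β \ Iio α = e β \ Iio δ := by
        intro α h3 h4
        ext y
        simp only [mem_sdiff, mem_Iio, not_lt, and_congr_right_iff]
        refine fun hy ↦ ⟨fun h ↦ ?_, fun h ↦ h4.le.trans h⟩
        by_contra! hlt
        exact ((hbd y hy hlt).trans h3).not_ge h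
      refine ⟨n + 1, max γ₀ γ, max_lt hγ₀ hγ, ?_, ?_, ?_⟩
      · intro l hl
        cases l with
        | zero => exact ⟨hδβ, hβ⟩
        | succ l => rw [walk_succ_eq]; exact hw l (by omega)
      · rw [walk_succ_eq]; exact hδe
      · intro α h3 h4 l hl
        cases l with
        | zero => rfl
        | succ l =>
          rw [walk_succ_eq, walk_succ_eq, hset α ((le_max_left _ _).trans_lt h3) h4]
          exact hα α ((le_max_right _ _).trans_lt h3) h4 l (by omega)

/-! ### `Γ` and the colour. -/

/-- The colour is read off from a walk along which `Γ` is constant until the point `b`. -/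
theorem col_eq {k : Ordinal.{u}} {f : Ordinal.{u} → Ordinal.{u} → Ordinal.{u}}
    {e : Ordinal.{u} → Set Ordinal.{u}} {α β b i : Ordinal.{u}} {n : ℕ}
    (hconst : ∀ l ≤ n, Gam k f α (walk e α β l) = i) (hb : walk e α β (n + 1) = b)
    (hne : Gam k f α b ≠ i) : col k f e α β = b := by
  have h0 : Gam k f α β = i := hconst 0 (Nat.zero_le _)
  rw [← hb, col]
  congr 1
  refine le_antisymm (Nat.sInf_le ?_) (le_csInf ⟨n + 1, ?_⟩ ?_)
  · simpa [hb, h0] using hne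
  · simpa [hb, h0] using hne
  · intro l hl
    by_contra! hlt
    exact hl ((hconst l (by omega)).trans h0.symm)

theorem gam_eq {k : Ordinal.{u}} {f : Ordinal.{u} → Ordinal.{u} → Ordinal.{u}}
    {α β i : Ordinal.{u}} (hi : i < k) (h : f β i ≤ f α i)
    (hlt : ∀ j, i < j → j < k → f α j < f β j) : Gam k f α β = i := by
  refine IsGreatest.csSup_eq ⟨⟨hi, h⟩, fun j hj ↦ ?_⟩
  by_contra! hij
  exact (hlt j hij hj.1).not_ge hj.2

theorem le_gam {k : Ordinal.{u}} {f : Ordinal.{u} → Ordinal.{u} → Ordinal.{u}}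
    {α β i : Ordinal.{u}} (hi : i < k) (h : f β i ≤ f α i) : i ≤ Gam k f α β :=
  le_csSup ⟨k, fun _ hj ↦ hj.1.le⟩ ⟨hi, h⟩

/-! ### Disjoint small sets and domination along the scale. -/

/-- Among `μ⁺` pairwise disjoint sets `t α`, some with arbitrarily large index lies above a given
bound. -/
theorem exists_gt_forall_mem_gt {μ : Cardinal.{u}} (hμ : ℵ₀ ≤ μ)
    {t : Ordinal.{u} → Set Ordinal.{u}}
    (hdisj : ∀ α < (Order.succ μ).ord, ∀ β < (Order.succ μ).ord, α ≠ β → Disjoint (t α) (t β))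
    {c : Ordinal.{u}} (hc : c < (Order.succ μ).ord) :
    ∃ α < (Order.succ μ).ord, c < α ∧ ∀ ζ ∈ t α, c < ζ := by
  have hreg : (Order.succ μ).IsRegular := isRegular_succ hμ
  have hlim : Order.IsSuccLimit (Order.succ μ).ord := isSuccLimit_ord hreg.aleph0_le
  -- By disjointness each `ζ ≤ c` rules out at most one index, so the excluded indices are bounded.
  have : ∀ ζ, ∃ a < (Order.succ μ).ord, ∀ α < (Order.succ μ).ord, ζ ∈ t α → α = a := fun ζ ↦ by
    by_cases h : ∃ a < (Order.succ μ).ord, ζ ∈ t a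
    · obtain ⟨a, ha, hζ⟩ := h
      refine ⟨a, ha, fun α hα hζ' ↦ ?_⟩
      by_contra hne
      exact disjoint_left.1 (hdisj α hα a ha hne) hζ' hζ
    · exact ⟨0, hreg.ord_pos, fun α hα hζ ↦ absurd ⟨α, hα, hζ⟩ h⟩
  choose a ha hu using this
  obtain ⟨γ, hγ, hlt⟩ := exists_lt_forall_mem_lt (s := Iio (Order.succ c)) (F := a)
    (o := (Order.succ μ).ord)
    (by rw [hreg.cof_ord]; exact mk_Iio_lt_lift (hlim.succ_lt hc)) fun x _ ↦ ha x
  refine ⟨Order.succ (max γ c), hlim.succ_lt (max_lt hγ hc),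
    Order.lt_succ_iff.2 (le_max_right _ _), fun ζ hζ ↦ ?_⟩
  by_contra! hle
  have h1 := hlt ζ (Order.lt_succ_iff.2 hle)
  rw [← hu ζ _ (hlim.succ_lt (max_lt hγ hc)) hζ] at h1
  exact ((Order.lt_succ_iff.2 (le_max_left _ _)).trans h1).false

theorem IsScale.lt_of_lt_cof {μ : Cardinal.{u}} {m : Ordinal.{u} → Cardinal.{u}}
    {f : Ordinal.{u} → Ordinal.{u} → Ordinal.{u}} (hf : IsScale μ m f) {i : Ordinal.{u}}
    (hi : i < μ.ord.cof.ord) : μ.ord.cof < m i :=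
  hf.cof_lt.trans_le
    (hf.strictMonoOn.monotoneOn ((zero_le (a := i)).trans_lt hi) hi (zero_le (a := i)))

theorem IsScale.ord_le {μ : Cardinal.{u}} {m : Ordinal.{u} → Cardinal.{u}}
    {f : Ordinal.{u} → Ordinal.{u} → Ordinal.{u}} (hf : IsScale μ m f) {i : Ordinal.{u}}
    (hi : i < μ.ord.cof.ord) : (m i).ord ≤ μ.ord :=
  ord_le_ord.2 (hf.isLUB.1 (mem_image_of_mem m hi))

/-- For almost all `i`, the values at `i` and at `i + 1` of the functions indexed by `t α` can be
made simultaneously as large as desired. -/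
theorem IsScale.exists_forall_mem_le {μ : Cardinal.{u}} (hμ : μ.IsSingular)
    {m : Ordinal.{u} → Cardinal.{u}} {f : Ordinal.{u} → Ordinal.{u} → Ordinal.{u}}
    (hf : IsScale μ m f) {t : Ordinal.{u} → Set Ordinal.{u}}
    (ht : ∀ α < (Order.succ μ).ord, t α ⊆ Iio (Order.succ μ).ord ∧
      #(t α) < Cardinal.lift.{u + 1} μ.ord.cof)
    (hdisj : ∀ α < (Order.succ μ).ord, ∀ β < (Order.succ μ).ord, α ≠ β → Disjoint (t α) (t β)) :
    ∃ i₀ < μ.ord.cof.ord, ∀ i, i₀ < i → i < μ.ord.cof.ord → ∀ γ < (Order.succ μ).ord,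
      ∀ η₀ < (m i).ord, ∀ η₁ < (m (Order.succ i)).ord, ∃ α < (Order.succ μ).ord, γ < α ∧
        ∀ ζ ∈ t α, γ < ζ ∧ η₀ ≤ f ζ i ∧ η₁ ≤ f ζ (Order.succ i) := by
  by_contra! hcon
  have hκ : μ.ord.cof.IsRegular := isRegular_cof (isSuccLimit_ord hμ.aleph0_le)
  have hklim : Order.IsSuccLimit μ.ord.cof.ord := isSuccLimit_ord hκ.aleph0_le
  have hreg : (Order.succ μ).IsRegular := isRegular_succ hμ.aleph0_le
  set lam := (Order.succ μ).ord with hlam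
  set k := μ.ord.cof.ord with hk
  let Bad (i γ η₀ η₁ : Ordinal.{u}) : Prop := ∀ α < lam, γ < α →
    ∃ ζ ∈ t α, γ < ζ → η₀ ≤ f ζ i → f ζ (Order.succ i) < η₁
  have hsel : ∀ i < k, ∃ γ < lam, ∃ η₀ < (m i).ord, ∃ η₁ < (m (Order.succ i)).ord,
      (∃ γ < lam, ∃ η₀ < (m i).ord, ∃ η₁ < (m (Order.succ i)).ord, Bad i γ η₀ η₁) →
        Bad i γ η₀ η₁ := fun i hi ↦ by
    by_cases h : ∃ γ < lam, ∃ η₀ < (m i).ord, ∃ η₁ < (m (Order.succ i)).ord, Bad i γ η₀ η₁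
    · obtain ⟨γ, hγ, η₀, h0, η₁, h1, hb⟩ := h
      exact ⟨γ, hγ, η₀, h0, η₁, h1, fun _ ↦ hb⟩
    · exact ⟨0, hreg.ord_pos, 0, (hf.regular i hi).ord_pos, 0,
        (hf.regular _ (hklim.succ_lt hi)).ord_pos, fun h' ↦ absurd h' h⟩
  choose! γ hγ η₀ h0 η₁ h1 hbad using hsel
  -- `g` shifts `η₁` by one, so that `g (i + 1)` bounds `η₁ i` and `g` lies in the product.
  have hg : ∀ j < k, ∃ y < (m j).ord, ∀ i, j = Order.succ i → η₁ i ≤ y := fun j hj ↦ by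
    by_cases h : ∃ i, j = Order.succ i
    · obtain ⟨i, rfl⟩ := h
      refine ⟨η₁ i, h1 i ((Order.lt_succ i).trans hj), fun i' hi' ↦ ?_⟩
      rw [Order.succ_injective hi']
    · exact ⟨0, (hf.regular j hj).ord_pos, fun i hi ↦ absurd ⟨i, hi⟩ h⟩
  choose! g hgm hgη using hg
  obtain ⟨a, ha, ha'⟩ := hf.cofinal η₀ h0
  obtain ⟨b, hb, hb'⟩ := hf.cofinal g hgm
  obtain ⟨c, hc, hγc⟩ := exists_lt_forall_mem_lt (s := Iio k) (F := γ) (o := lam) (by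
    rw [hreg.cof_ord]
    refine mk_Iio_lt_lift (ord_lt_ord.2 ?_)
    exact hμ.cof_ord_lt.trans (Order.lt_succ μ)) hγ
  obtain ⟨α, hα, hcα, hζ⟩ := exists_gt_forall_mem_gt hμ.aleph0_le hdisj
    (max_lt (max_lt ha hb) hc)
  have hev : ∀ ζ ∈ t α, ∃ j < k, ∀ i, j < i → i < k → η₀ i < f ζ i ∧ g i < f ζ i := by
    intro ζ hζt
    have hζlam := (ht α hα).1 hζt
    have hlt := hζ ζ hζt
    obtain ⟨j1, hj1, e1⟩ := ha'
    obtain ⟨j2, hj2, e2⟩ := hb'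
    obtain ⟨j3, hj3, e3⟩ := hf.increasing a ζ
      (((le_max_left _ _).trans (le_max_left _ _)).trans_lt hlt) hζlam
    obtain ⟨j4, hj4, e4⟩ := hf.increasing b ζ
      (((le_max_right _ _).trans (le_max_left _ _)).trans_lt hlt) hζlam
    refine ⟨max (max j1 j2) (max j3 j4), max_lt (max_lt hj1 hj2) (max_lt hj3 hj4),
      fun i hi hik ↦ ?_⟩
    simp only [max_lt_iff] at hi
    constructor
    · exact (lt_of_not_ge fun h ↦ (e1 i hik h).not_gt hi.1.1).trans
        (lt_of_not_ge fun h ↦ (e3 i hik h).not_gt hi.2.1)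
    · exact (lt_of_not_ge fun h ↦ (e2 i hik h).not_gt hi.1.2).trans
        (lt_of_not_ge fun h ↦ (e4 i hik h).not_gt hi.2.2)
  choose! J hJ hJ' using hev
  -- `t α` has fewer than `κ` members and `κ` is regular, so one threshold serves them all; a bad
  -- `i` beyond it is contradictory.
  obtain ⟨j, hj, hJj⟩ := exists_lt_forall_mem_lt (s := t α) (F := J) (o := k)
    (by rw [hκ.cof_ord]; exact (ht α hα).2) hJ
  obtain ⟨i, hji, hik, hex⟩ := hcon j hj
  obtain ⟨ζ, hζt, himp⟩ := hbad i hik hex α hα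
    ((hγc i hik).trans ((le_max_right _ _).trans_lt hcα))
  have hζJ := (hJj ζ hζt).trans hji
  refine (himp ((hγc i hik).trans ((le_max_right _ _).trans_lt (hζ ζ hζt)))
    (hJ' ζ hζt i hζJ hik).1.le).not_ge ?_
  exact (hgη _ (hklim.succ_lt hik) i rfl).trans
    (hJ' ζ hζt _ (hζJ.trans (Order.lt_succ i)) (hklim.succ_lt hik)).2.le

/-- A family of fewer than `m j` values at each `j`, given by the sets `T i η` for `i < j` and
`η < m i`, is dominated by a member of the scale. -/
theorem IsScale.exists_dominating {μ : Cardinal.{u}}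
    {m : Ordinal.{u} → Cardinal.{u}} {f : Ordinal.{u} → Ordinal.{u} → Ordinal.{u}}
    (hf : IsScale μ m f) {T : Ordinal.{u} → Ordinal.{u} → Set Ordinal.{u}}
    (hT : ∀ i < μ.ord.cof.ord, ∀ η < (m i).ord, T i η ⊆ Iio (Order.succ μ).ord ∧
      #(T i η) < Cardinal.lift.{u + 1} μ.ord.cof) :
    ∃ ε < (Order.succ μ).ord, ∃ j₀ < μ.ord.cof.ord, ∀ j, j₀ < j → j < μ.ord.cof.ord →
      ∀ i < j, ∀ η < (m i).ord, ∀ ζ ∈ T i η, f ζ j < f ε j := by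
  set k := μ.ord.cof.ord with hk
  have key : ∀ j < k, ∃ y < (m j).ord, ∀ i < j, ∀ η < (m i).ord, ∀ ζ ∈ T i η, f ζ j < y := by
    intro j hj
    have hr := hf.regular j hj
    have hκj := hf.lt_of_lt_cof hj
    -- Regularity of `m j` is used three times: over `ζ` (fewer than `κ`), over `η < m i < m j`, and
    -- over `i < j < κ < m j`.
    have h1 : ∀ i < j, ∃ y < (m j).ord, ∀ η < (m i).ord, ∀ ζ ∈ T i η, f ζ j < y := by
      intro i hi
      have hik := hi.trans hj
      have h2 : ∀ η < (m i).ord, ∃ y < (m j).ord, ∀ ζ ∈ T i η, f ζ j < y := fun η hη ↦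
        exists_lt_forall_mem_lt (s := T i η) (F := fun ζ ↦ f ζ j) (by
          rw [hr.cof_ord]
          exact (hT i hik η hη).2.trans (Cardinal.lift_lt.2 hκj))
          fun ζ hζ ↦ hf.mem_prod ζ ((hT i hik η hη).1 hζ) j hj
      choose! y hy hlt using h2
      obtain ⟨z, hz, hyz⟩ := exists_lt_forall_mem_lt (s := Iio (m i).ord) (F := y)
        (o := (m j).ord) (by
          rw [hr.cof_ord]
          exact mk_Iio_lt_lift (ord_lt_ord.2 (hf.strictMonoOn hik hj hi))) hy
      exact ⟨z, hz, fun η hη ζ hζ ↦ (hlt η hη ζ hζ).trans (hyz η hη)⟩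
    choose! y hy hlt using h1
    obtain ⟨z, hz, hyz⟩ := exists_lt_forall_mem_lt (s := Iio j) (F := y)
      (o := (m j).ord) (by
        rw [hr.cof_ord]
        exact mk_Iio_lt_lift (hj.trans (ord_lt_ord.2 hκj))) hy
    exact ⟨z, hz, fun i hi η hη ζ hζ ↦ (hlt i hi η hη ζ hζ).trans (hyz i hi)⟩
  choose! g hg hlt using key
  obtain ⟨ε, hε, j₀, hj₀, h⟩ := hf.cofinal g hg
  exact ⟨ε, hε, j₀, hj₀, fun j hjj hj i hi η hη ζ hζ ↦ (hlt j hj i hi η hη ζ hζ).trans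
    (lt_of_not_ge fun hle ↦ (h j hj hle).not_gt hjj)⟩

/-! ### Uniform bounds, and walks through `C δ`. -/

/-- If `cof b` exceeds a regular cardinal `c`, a function from `b` to `c` is bounded on an unbounded
subset of `b`. -/
theorem exists_unboundedlyMany_le {c : Cardinal.{u}} (hc : c.IsRegular) {b : Ordinal.{u}}
    (hb : c < b.cof) {J : Ordinal.{u} → Ordinal.{u}} (hJ : ∀ γ < b, J γ < c.ord) :
    ∃ j < c.ord, UnboundedlyMany b fun γ ↦ J γ ≤ j := by
  have hlim : Order.IsSuccLimit b :=
    one_lt_cof_iff.1 ((one_lt_aleph0.trans_le hc.aleph0_le).trans hb)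
  by_contra! hcon
  simp only [UnboundedlyMany, not_forall, not_exists, not_and, not_le] at hcon
  choose! g hg hlt using hcon
  obtain ⟨γ, hγ, hgγ⟩ := exists_lt_forall_mem_lt (s := Iio c.ord) (F := g) (o := b)
    (mk_Iio_lt_lift (ord_lt_ord.2 hb)) hg
  have h1 := hlim.succ_lt hγ
  exact (hlt _ (hJ _ h1) _ ((hgγ _ (hJ _ h1)).trans (Order.lt_succ γ)) h1).false

theorem exists_lt_forall_le_nat_lt {o : Ordinal.{u}} (n : ℕ) {F : ℕ → Ordinal.{u}}
    (hF : ∀ l ≤ n, F l < o) : ∃ γ < o, ∀ l ≤ n, F l ≤ γ := by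
  obtain ⟨l, hl, h⟩ := Finset.exists_max_image (Finset.range (n + 1)) F ⟨0, by simp⟩
  exact ⟨F l, hF l (by simpa [Nat.lt_succ_iff] using hl),
    fun l' hl' ↦ h l' (by simpa [Nat.lt_succ_iff] using hl')⟩

/-- Serves for values along walks, whose finite lengths `n ξ` need not have a common bound. -/
theorem exists_lt_forall_mem_forall_le_nat_le {o : Ordinal.{u}} {X : Set Ordinal.{u}}
    (hX : #X < Cardinal.lift.{u + 1} o.cof) {n : Ordinal.{u} → ℕ} {F : Ordinal.{u} → ℕ → Ordinal.{u}}
    (hF : ∀ ξ ∈ X, ∀ l ≤ n ξ, F ξ l < o) : ∃ γ < o, ∀ ξ ∈ X, ∀ l ≤ n ξ, F ξ l ≤ γ := by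
  choose! G hG hle using fun ξ (hξ : ξ ∈ X) ↦ exists_lt_forall_le_nat_lt (n ξ) (hF ξ hξ)
  obtain ⟨γ, hγ, h⟩ := exists_lt_forall_mem_lt hX hG
  exact ⟨γ, hγ, fun ξ hξ l hl ↦ (hle ξ hξ l hl).trans (h ξ hξ).le⟩

/-- The walks from the points of a small set `X` to a point of `S` pass through ladders which
contain `C δ`, with a common bound on their cardinalities. -/
theorem exists_common_walk {μ : Cardinal.{u}} (hμ : μ.IsSingular) {δ : Ordinal.{u}}
    {S : Set Ordinal.{u}} {C e : Ordinal.{u} → Set Ordinal.{u}}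
    (he : IsCSequence (Order.succ μ).ord e) (hsw : Swallows μ e S C) (hδS : δ ∈ S)
    (hδ : δ.cof = μ.ord.cof) {X : Set Ordinal.{u}} (hX : #X < Cardinal.lift.{u + 1} μ.ord.cof)
    (hXδ : ∀ ξ ∈ X, δ < ξ ∧ ξ < (Order.succ μ).ord) :
    ∃ n : Ordinal.{u} → ℕ, ∃ γ₀ < δ, ∃ ν < μ, ∀ ξ ∈ X,
      (∀ l ≤ n ξ, δ < walk e δ ξ l ∧ walk e δ ξ l < (Order.succ μ).ord) ∧
      C δ ⊆ e (walk e δ ξ (n ξ)) ∧ #(e (walk e δ ξ (n ξ))) ≤ Cardinal.lift.{u + 1} ν ∧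
      ∀ α, γ₀ < α → α < δ → ∀ l ≤ n ξ, walk e α ξ l = walk e δ ξ l := by
  have hκ : μ.ord.cof.IsRegular := isRegular_cof (isSuccLimit_ord hμ.aleph0_le)
  have hδlim : Order.IsSuccLimit δ :=
    one_lt_cof_iff.1 (hδ ▸ one_lt_aleph0.trans_le hκ.aleph0_le)
  choose! n γ hγ hw hδe hα using fun ξ (hξ : ξ ∈ X) ↦
    exists_walk_eq he hδlim ξ (hXδ ξ hξ).1 (hXδ ξ hξ).2
  obtain ⟨γ₀, hγ₀, hlt⟩ := exists_lt_forall_mem_lt (hδ ▸ hX) hγ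
  -- Ladder sizes are recast as ordinals below `μ.ord`, where fewer than `cf μ` of them are bounded.
  have hc : ∀ ξ ∈ X, ∃ c < μ.ord, #(e (walk e δ ξ (n ξ))) = Cardinal.lift.{u + 1} c.card := by
    intro ξ hξ
    have h := (hsw _ (hw ξ hξ _ le_rfl).2).1
    obtain ⟨c, hc⟩ := mem_range_lift_of_le h.le
    refine ⟨c.ord, ord_lt_ord.2 ?_, by rw [card_ord, hc]⟩
    rwa [← hc, Cardinal.lift_lt] at h
  choose! c hcμ hcard using hc
  obtain ⟨ν, hν, hcν⟩ := exists_lt_forall_mem_lt hX hcμ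
  refine ⟨n, γ₀, hγ₀, ν.card, lt_ord.1 hν, fun ξ hξ ↦ ⟨hw ξ hξ, ?_, ?_, ?_⟩⟩
  · exact (hsw _ (hw ξ hξ _ le_rfl).2).2 δ ⟨hδe ξ hξ, hδS⟩
  · rw [hcard ξ hξ, Cardinal.lift_le]
    exact card_le_card (hcν ξ hξ).le
  · exact fun α h1 h2 l hl ↦ hα ξ hξ α ((hlt ξ hξ).trans h1) h2 l hl

/-- Just below a point `b` of large cofinality in the last ladder, the walk passes through `b`. -/
theorem exists_forall_walk_succ_eq {e : Ordinal.{u} → Set Ordinal.{u}} {b : Ordinal.{u}}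
    {X : Set Ordinal.{u}} (hX : #X < Cardinal.lift.{u + 1} b.cof) {v : Ordinal.{u} → Ordinal.{u}}
    (hbv : ∀ ξ ∈ X, b ∈ e (v ξ)) (hcard : ∀ ξ ∈ X, #(e (v ξ)) < Cardinal.lift.{u + 1} b.cof) :
    ∃ γ < b, ∀ ζ, γ < ζ → ζ < b → ∀ ξ ∈ X, sInf (e (v ξ) \ Iio ζ) = b := by
  -- The ladder has fewer than `cf b` points below `b`, so they are bounded below `b`.
  have h1 : ∀ ξ ∈ X, ∃ γ < b, ∀ y ∈ e (v ξ) ∩ Iio b, y < γ := fun ξ hξ ↦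
    exists_lt_forall_mem_lt (F := fun y ↦ y)
      ((mk_le_mk_of_subset inter_subset_left).trans_lt (hcard ξ hξ)) fun y hy ↦ hy.2
  choose! g hg hlt using h1
  obtain ⟨γ, hγ, hgγ⟩ := exists_lt_forall_mem_lt hX hg
  refine ⟨γ, hγ, fun ζ h1 h2 ξ hξ ↦ ?_⟩
  refine IsLeast.csInf_eq ⟨⟨hbv ξ hξ, not_lt.2 h2.le⟩, fun y hy ↦ ?_⟩
  by_contra! hyb
  exact hy.2 (((hlt ξ hξ y ⟨hy.1, hyb⟩).trans (hgγ ξ hξ)).trans h1)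

/-- If no such point existed, `A` would lie inside a single generator. -/
theorem exists_mem_of_notMem_generatedIdeal {μ : Cardinal.{u}} {δ : Ordinal.{u}}
    {C A : Set Ordinal.{u}} (hA : A ⊆ C) (h : A ∉ generatedIdeal (basicSmallSets μ δ C))
    {ν : Cardinal.{u}} (hν : ν < μ) {β : Ordinal.{u}} (hβ : β < δ) :
    ∃ b ∈ A, ν ≤ b.cof ∧ β ≤ b := by
  by_contra! hcon
  refine h ⟨{{γ | γ ∈ C ∧ (γ ∈ acc C ∨ γ.cof < ν ∨ γ < β)}}, finite_singleton _, ?_, ?_⟩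
  · rintro _ rfl
    exact ⟨ν, hν, β, hβ, rfl⟩
  · intro b hb
    refine ⟨_, rfl, hA hb, ?_⟩
    by_cases hc : ν ≤ b.cof
    · exact .inr (.inr (hcon b hb hc))
    · exact .inr (.inl (not_le.1 hc))

end SingWalk

/-! ### The theorem. -/

open SingWalk in
theorem theorem4p2 {μ κ : Cardinal.{u}} (hμ : μ.IsSingular) (hκ : μ.ord.cof = κ)
    {lam : Ordinal.{u}} (hlam : lam = (Order.succ μ).ord)
    (S : Set Ordinal.{u}) (C : Ordinal.{u} → Set Ordinal.{u})
    (I : Ordinal.{u} → Set (Set Ordinal.{u})) (hCI : SingWalk.IsGoodPair μ S C I)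
    (e : Ordinal.{u} → Set Ordinal.{u}) (he : SingWalk.IsCSequence lam e)
    (hsw : SingWalk.Swallows μ e S C)
    (m : Ordinal.{u} → Cardinal.{u}) (f : Ordinal.{u} → Ordinal.{u} → Ordinal.{u})
    (hf : SingWalk.IsScale μ m f)
    (t : Ordinal.{u} → Set Ordinal.{u})
    (ht : ∀ α < lam, t α ⊆ Set.Iio lam ∧ Cardinal.mk (t α) < Cardinal.lift.{u + 1} κ)
    (hdisj : ∀ α < lam, ∀ β < lam, α ≠ β → Disjoint (t α) (t β)) :
    {b | b < lam ∧ ¬ SingWalk.UnboundedlyMany lam fun β =>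
        SingWalk.AlmostAll κ.ord fun i =>
          SingWalk.UnboundedlyMany b fun α =>
            ∀ ζ ∈ t α, ∀ ξ ∈ t β,
              ζ < ξ ∧ SingWalk.col κ.ord f e ζ ξ = b ∧ SingWalk.Gam κ.ord f ζ ξ = i}
      ∈ SingWalk.idP lam S C I := by
  subst hκ
  have hreg : (Order.succ μ).IsRegular := isRegular_succ hμ.aleph0_le
  have hlamlim : Order.IsSuccLimit lam := hlam ▸ isSuccLimit_ord hreg.aleph0_le
  have hlamcof : lam.cof = Order.succ μ := hlam ▸ hreg.cof_ord
  have hκ : μ.ord.cof.IsRegular := isRegular_cof (isSuccLimit_ord hμ.aleph0_le)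
  have hklim : Order.IsSuccLimit μ.ord.cof.ord := isSuccLimit_ord hκ.aleph0_le
  have hμlam : μ.ord < lam := hlam ▸ ord_lt_ord.2 (Order.lt_succ μ)
  have hkμ : μ.ord.cof.ord < μ.ord := ord_lt_ord.2 hμ.cof_ord_lt
  set k := μ.ord.cof.ord with hk
  obtain ⟨i₀, hi₀, hlarge⟩ := hf.exists_forall_mem_le hμ (hlam ▸ ht) (hlam ▸ hdisj)
  rw [← hlam] at hlarge
  -- `a γ i η₀ η₁` is an index above `γ` at which the values at `i` and `i + 1` are large, and
  -- `r γ i η₀ η₁` bounds it together with its set.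
  have hsel : ∀ γ < lam, ∀ i η₀ η₁, ∃ α < lam, ∃ r < lam, i₀ < i → i < k → η₀ < (m i).ord →
      η₁ < (m (Order.succ i)).ord → γ < α ∧ α < r ∧
        ∀ ζ ∈ t α, γ < ζ ∧ ζ < r ∧ η₀ ≤ f ζ i ∧ η₁ ≤ f ζ (Order.succ i) := by
    intro γ hγ i η₀ η₁
    by_cases h : i₀ < i ∧ i < k ∧ η₀ < (m i).ord ∧ η₁ < (m (Order.succ i)).ord
    · obtain ⟨α, hα, hγα, hζ⟩ := hlarge i h.1 h.2.1 γ hγ η₀ h.2.2.1 η₁ h.2.2.2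
      obtain ⟨r, hr, hlt⟩ := exists_lt_forall_mem_lt (s := t α) (F := fun ζ ↦ ζ) (o := lam) (by
        rw [hlamcof]
        refine (ht α hα).2.trans (Cardinal.lift_lt.2 ?_)
        exact hμ.cof_ord_lt.trans (Order.lt_succ μ)) fun ζ hζ ↦ (ht α hα).1 hζ
      refine ⟨α, hα, max r (Order.succ α), max_lt hr (hlamlim.succ_lt hα), fun _ _ _ _ ↦
        ⟨hγα, (Order.lt_succ α).trans_le (le_max_right _ _), fun ζ hζt ↦
          ⟨(hζ ζ hζt).1, (hlt ζ hζt).trans_le (le_max_left _ _), (hζ ζ hζt).2⟩⟩⟩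
    · exact ⟨0, hlamlim.bot_lt, 0, hlamlim.bot_lt, fun h1 h2 h3 h4 ↦ absurd ⟨h1, h2, h3, h4⟩ h⟩
  choose! a ha r hr hspec using hsel
  -- `ε` must work for all `i` and `η` together, since these are fixed only once the walks are
  -- known.
  have hdom : ∀ γ < lam, ∀ b < lam, ∃ ε < lam, ∃ j₀ < k, ∀ j, j₀ < j → j < k →
      ∀ i < j, ∀ η < (m i).ord, ∀ ζ ∈ t (a γ i η (f b (Order.succ i))), f ζ j < f ε j := by
    intro γ hγ b hb
    rw [hlam]
    refine hf.exists_dominating (T := fun i η ↦ t (a γ i η (f b (Order.succ i))))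
      fun i hi η hη ↦ ?_
    rw [← hlam]
    exact ht _ (ha γ hγ _ _ _)
  choose! ε hε j₀ hj₀ hdom using hdom
  -- The parameters `i`, `η₀`, `η₁` all range below `μ`, so `R` codes only `μ` functions.
  let R : Ordinal.{u} → Ordinal.{u} → Iio μ.ord × Iio μ.ord × Iio μ.ord → Ordinal.{u} :=
    fun γ b p ↦ max (ε γ b) (r γ p.1 p.2.1 p.2.2)
  have hR : ∀ γ < (Order.succ μ).ord, ∀ b < (Order.succ μ).ord, ∀ x,
      R γ b x < (Order.succ μ).ord := by
    rw [← hlam]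
    exact fun γ hγ b hb x ↦ max_lt (hε γ hγ b hb) (hr γ hγ _ _ _)
  have hcardι : #(Iio μ.ord × Iio μ.ord × Iio μ.ord) ≤ Cardinal.lift.{u + 1} μ := by
    have hμ' : ℵ₀ ≤ Cardinal.lift.{u + 1} μ := by simpa using hμ.aleph0_le
    have hc : #(Iio μ.ord) = Cardinal.lift.{u + 1} μ := by
      rw [Cardinal.mk_Iio_ordinal, card_ord]
    simp only [mk_prod, Cardinal.lift_id, hc]
    exact mul_le_of_le hμ' le_rfl (mul_le_of_le hμ' le_rfl le_rfl)
  have hclub := isClubIn_closedUnder hμ.aleph0_le hcardι R hR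
  rw [← hlam] at hclub
  refine ⟨fun b hb ↦ hb.1, _, hclub, fun δ hδ ↦ ?_⟩
  obtain ⟨hδS, hδlam, hδcl⟩ := hδ
  by_contra hpos
  rw [hCI.ideal_eq δ hδS] at hpos
  have hδcof := hCI.cof_eq δ hδS
  -- A bound beyond which no `β` is a witness for any of the bad points of `C δ`.
  have hρ : ∀ b, ∃ ρ < lam, (b < lam ∧ ¬ UnboundedlyMany lam fun β =>
        AlmostAll k fun i => UnboundedlyMany b fun α => ∀ ζ ∈ t α, ∀ ξ ∈ t β,
              ζ < ξ ∧ col k f e ζ ξ = b ∧ Gam k f ζ ξ = i) → ∀ β, ρ < β → β < lam →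
        ¬ AlmostAll k fun i => UnboundedlyMany b fun α => ∀ ζ ∈ t α, ∀ ξ ∈ t β,
              ζ < ξ ∧ col k f e ζ ξ = b ∧ Gam k f ζ ξ = i := by
    intro b
    by_cases h : b < lam ∧ ¬ UnboundedlyMany lam fun β =>
        AlmostAll k fun i => UnboundedlyMany b fun α => ∀ ζ ∈ t α, ∀ ξ ∈ t β,
              ζ < ξ ∧ col k f e ζ ξ = b ∧ Gam k f ζ ξ = i
    · have h2 := h.2
      rw [UnboundedlyMany] at h2
      push Not at h2
      obtain ⟨ρ, hρ, hb⟩ := h2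
      exact ⟨ρ, hρ, fun _ ↦ hb⟩
    · exact ⟨0, hlamlim.bot_lt, fun h' ↦ absurd h' h⟩
  choose ρ hρlam hρ using hρ
  obtain ⟨ρ', hρ', hρC⟩ := exists_lt_forall_mem_lt (s := C δ) (F := ρ) (o := lam) (by
    obtain ⟨ν, hν, hle⟩ := hCI.card_bound
    rw [hlamcof]
    exact (hle δ hδS).trans_lt (Cardinal.lift_lt.2 (hν.trans (Order.lt_succ μ))))
    fun b _ ↦ hρlam b
  -- `β` precedes `b`, whose cofinality must exceed ladder sizes depending on `β`; hence the bound
  -- `ρ'` uniform over `C δ`.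
  obtain ⟨β, hβ, hρβ, hβt⟩ := exists_gt_forall_mem_gt hμ.aleph0_le (hlam ▸ hdisj)
    (hlam ▸ max_lt hρ' hδlam)
  rw [← hlam] at hβ
  have hXδ : ∀ ξ ∈ t β, δ < ξ ∧ ξ < (Order.succ μ).ord := fun ξ hξ ↦
    ⟨(le_max_right _ _).trans_lt (hβt ξ hξ), hlam ▸ (ht β hβ).1 hξ⟩
  obtain ⟨n, γ₀, hγ₀, ν, hν, hwalk⟩ :=
    exists_common_walk hμ (hlam ▸ he) hsw hδS hδcof (ht β hβ).2 hXδ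
  have hδlim : Order.IsSuccLimit δ :=
    one_lt_cof_iff.1 (hδcof ▸ one_lt_aleph0.trans_le hκ.aleph0_le)
  obtain ⟨b, ⟨⟨⟨hblam, hbcl⟩, hbad⟩, hbC⟩, hbcof, hγ₀b⟩ :=
    exists_mem_of_notMem_generatedIdeal inter_subset_right hpos
      (hμ.isSuccLimit.succ_lt (max_lt hν hμ.cof_ord_lt)) (hδlim.succ_lt hγ₀)
  have hνb : ν < b.cof := (le_max_left _ _).trans_lt (Order.succ_le_iff.1 hbcof)
  have hκb : μ.ord.cof < b.cof := (le_max_right _ _).trans_lt (Order.succ_le_iff.1 hbcof)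
  rw [Order.succ_le_iff] at hγ₀b
  have hbδ : b < δ := (hCI.club δ hδS).1 hbC
  apply hρ b hbad β ((hρC b hbC).trans ((le_max_left _ _).trans_lt hρβ)) hβ
  have hXb : #(t β) < Cardinal.lift.{u + 1} b.cof :=
    (ht β hβ).2.trans (Cardinal.lift_lt.2 hκb)
  obtain ⟨γ₁, hγ₁, hstep⟩ := exists_forall_walk_succ_eq (e := e)
    (v := fun ξ ↦ walk e δ ξ (n ξ)) hXb (fun ξ hξ ↦ (hwalk ξ hξ).2.1 hbC)
    fun ξ hξ ↦ (hwalk ξ hξ).2.2.1.trans_lt (Cardinal.lift_lt.2 hνb)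
  -- Beyond `J γ` the functions `f w`, for `w` on one of the walks, dominate everything that
  -- depends on `γ` and `b`.
  have hJ : ∀ γ < b, ∃ J < k, ∀ j, J < j → j < k → ∀ ξ ∈ t β, ∀ l ≤ n ξ, ∀ i < j,
      ∀ η < (m i).ord, ∀ ζ ∈ t (a γ i η (f b (Order.succ i))), f ζ j < f (walk e δ ξ l) j := by
    intro γ hγ
    have hγlam := hγ.trans hblam
    -- Closure of `δ` is used here because `ε` takes `b` itself as argument. The zero parameters are
    -- fillers.
    have hεδ : ε γ b < δ := (le_max_left _ _).trans_lt (hδcl γ (hγ.trans hbδ) b hbδ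
      (⟨0, (isSuccLimit_ord hμ.aleph0_le).bot_lt⟩, ⟨0, (isSuccLimit_ord hμ.aleph0_le).bot_lt⟩,
        ⟨0, (isSuccLimit_ord hμ.aleph0_le).bot_lt⟩))
    have hinc : ∀ ξ, ∀ l, ξ ∈ t β → l ≤ n ξ → EvLT k (f (ε γ b)) (f (walk e δ ξ l)) :=
      fun ξ l hξ hl ↦ hf.increasing _ _ (hεδ.trans ((hwalk ξ hξ).1 l hl).1)
        ((hwalk ξ hξ).1 l hl).2
    choose! F hF hFle using hinc
    obtain ⟨J, hJ, hFJ⟩ := exists_lt_forall_mem_forall_le_nat_le (o := k) (X := t β) (n := n)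
      (F := F) (by rw [hκ.cof_ord]; exact (ht β hβ).2) fun ξ hξ l hl ↦ hF ξ l hξ hl
    refine ⟨max J (j₀ γ b), max_lt hJ (hj₀ γ hγlam b hblam), fun j hj hjk ξ hξ l hl i hi η hη
      ζ hζ ↦ ?_⟩
    refine (hdom γ hγlam b hblam j ((le_max_right _ _).trans_lt hj) hjk i hi η hη ζ hζ).trans
      (lt_of_not_ge fun hle ↦ ?_)
    exact (((hFle ξ l hξ hl j hjk hle).trans (hFJ ξ hξ l hl)).trans (le_max_left _ _)).not_gt hj
  choose! J hJk hJ using hJ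
  -- The threshold for `i` has to be fixed before `γ`, whereas `J γ` depends on `γ`.
  obtain ⟨j₁, hj₁, hunb⟩ := exists_unboundedlyMany_le hκ hκb hJk
  refine ⟨max j₁ i₀, max_lt hj₁ hi₀, fun i hi hik γ hγ ↦ ?_⟩
  have hj₁i : j₁ < i := (le_max_left _ _).trans_lt hi
  have hi₀i : i₀ < i := (le_max_right _ _).trans_lt hi
  have hsik := hklim.succ_lt hik
  obtain ⟨γ', hγ', hγ'b, hJγ'⟩ := hunb (max γ γ₁ ⊔ γ₀) (max_lt (max_lt hγ hγ₁) hγ₀b)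
  simp only [sup_lt_iff] at hγ'
  obtain ⟨η, hη, hηle⟩ := exists_lt_forall_mem_forall_le_nat_le (o := (m i).ord) (X := t β)
    (n := n) (F := fun ξ l ↦ f (walk e δ ξ l) i) (by
      rw [(hf.regular i hik).cof_ord]
      exact (ht β hβ).2.trans (Cardinal.lift_lt.2 (hf.lt_of_lt_cof hik)))
    fun ξ hξ l hl ↦ hf.mem_prod _ ((hwalk ξ hξ).1 l hl).2 i hik
  have hη₁ := hf.mem_prod b (hlam ▸ hblam) _ hsik
  obtain ⟨hγα, hαr, hζ⟩ := hspec γ' (hγ'b.trans hblam) i η _ hi₀i hik hη hη₁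
  -- Closure of `b`; `r` ignores the second argument of `R`, so `γ'` fills it.
  have hrb : r γ' i η (f b (Order.succ i)) < b := (le_max_right _ _).trans_lt
    (hbcl γ' hγ'b γ' hγ'b (⟨i, hik.trans hkμ⟩, ⟨η, hη.trans_le (hf.ord_le hik)⟩,
      ⟨_, hη₁.trans_le (hf.ord_le hsik)⟩))
  refine ⟨_, hγ'.1.1.trans hγα, hαr.trans hrb, fun ζ hζα ξ hξ ↦ ?_⟩
  obtain ⟨hγζ, hζr, hζη, hζη₁⟩ := hζ ζ hζα
  have hζb := hζr.trans hrb
  have hw : ∀ l ≤ n ξ, walk e ζ ξ l = walk e δ ξ l :=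
    (hwalk ξ hξ).2.2.2 ζ (hγ'.2.trans hγζ) (hζb.trans hbδ)
  have hgam : ∀ l ≤ n ξ, Gam k f ζ (walk e ζ ξ l) = i := by
    intro l hl
    rw [hw l hl]
    refine gam_eq hik ((hηle ξ hξ l hl).trans hζη) fun j hij hjk ↦ ?_
    exact hJ γ' hγ'b j ((hJγ'.trans_lt hj₁i).trans hij) hjk ξ hξ l hl i hij η hη ζ hζα
  -- The coordinate `i + 1` forces `Γ(ζ, b) ≥ i + 1`.
  have hne : Gam k f ζ b ≠ i := ((Order.lt_succ i).trans_le (le_gam hsik hζη₁)).ne'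
  have hlast : walk e ζ ξ (n ξ + 1) = b := by
    rw [walk, hw _ le_rfl]
    exact hstep ζ (hγ'.1.2.trans hγζ) hζb ξ hξ
  exact ⟨hζb.trans (hbδ.trans (hXδ ξ hξ).1), col_eq hgam hlast hne, hgam 0 (Nat.zero_le _)⟩
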